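/- Let $G$ be a compact Hausdorff group (not necessarily abelian) with identity $e$ and normalized Haar measure $m_G$, and let $L^2(G)=L^2(G,m_G)$ be the space of complex-valued square-integrable functions, with norm $\|\cdot\|_2$. Let $\widehat G$ be the set of unitary equivalence classes of irreducible (strongly continuous) unitary representations $\pi$ of $G$ on complex Hilbert spaces $\mathcal H_\pi$ (these are finite-dimensional), and put $d_\pi=\dim\mathcal H_\pi$. For $f\in L^2(G)$ let $$\widehat f(\pi)=\int_G f(t)\,\pi(t)^*\,dm_G(t),\qquad \pi\in\widehat G,$$ and let $\|T\|_{\mathcal B_2(\mathcal H_\pi)}=(\mathrm{tr}(T^*T))^{1/2}$ be the Hilbert–Schmidt norm. For $y\in G$ let $R_yf(x)=f(xy)$. Let $K$ be a bounded subset of $L^2(G)$. Then the following are equivalent: (i) $K$ is precompact, i.e. its closure in $L^2(G)$ is compact. (ii) $\widehat K=\{\widehat f: f\in K\}$ has uniform $\ell^2\text{-}\bigoplus_{\pi\in\widehat G}\mathcal B_2(\mathcal H_\pi)$-decay: for every $\epsilon>0$ there is a finite set $A\subset\widehat G$ such that $$\Big(\sum_{\pi\in\widehat G\setminus A} d_\pi\,\|\widehat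 f(\pi)\|_{\mathcal B_2(\mathcal H_\pi)}^2\Big)^{1/2}<\epsilon\quad\text{for all } f\in K.$$ (iii) $K$ is uniformly $L^2(G)$-equicontinuous: for every $\epsilon>0$ there is an open neighbourhood $O$ of $e$ such that $\|R_yf-f\|_2<\epsilon$ for all $f\in K$ and $y\in O$. -/

import Mathlib

open MeasureTheory
open scoped ENNReal

universe u

noncomputable section

namespace CompactGroup

/-- An irreducible unitary representation of a topological group `G`: a strongly continuous
homomorphism into the unitary operators of a nonzero complex Hilbert space which has no closed
invariant subspaces other than `0` and the whole space. -/
structure IrredUnitaryRep (G : Type u) [Group G] [TopologicalSpace G] where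
  /-- the representation space -/
  H : Type u
  [normedAddCommGroup : NormedAddCommGroup H]
  [innerProductSpace : InnerProductSpace ℂ H]
  [completeSpace : CompleteSpace H]
  [nontrivial : Nontrivial H]
  /-- the homomorphism into the unitary group -/
  toHom : G →* unitary (H →L[ℂ] H)
  continuous_apply : ∀ v : H, Continuous fun g : G => (toHom g : H →L[ℂ] H) v
  irreducible : ∀ M : Submodule ℂ H, IsClosed (M : Set H) →
    (∀ g : G, ∀ v ∈ M, (toHom g : H →L[ℂ] H) v ∈ M) → M = ⊥ ∨ M = ⊤

attribute [instance] IrredUnitaryRep.normedAddCommGroup IrredUnitaryRep.innerProductSpace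
  IrredUnitaryRep.completeSpace IrredUnitaryRep.nontrivial

section Dual

variable {G : Type u} [Group G] [TopologicalSpace G]

/-- The operator `π(g)`. -/
def IrredUnitaryRep.op (π : IrredUnitaryRep G) (g : G) : π.H →L[ℂ] π.H := π.toHom g

/-- Unitary equivalence: there is a unitary intertwining operator. -/
def IrredUnitaryRep.UnitarilyEquivalent (π ρ : IrredUnitaryRep G) : Prop :=
  ∃ U : π.H ≃ₗᵢ[ℂ] ρ.H, ∀ (g : G) (v : π.H), U (π.op g v) = ρ.op g (U v)

variable (G) in
/-- Unitary equivalence as a setoid. -/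
def IrredUnitaryRep.setoid : Setoid (IrredUnitaryRep G) where
  r := IrredUnitaryRep.UnitarilyEquivalent
  iseqv :=
    { refl := fun π => ⟨LinearIsometryEquiv.refl ℂ π.H, fun _ _ => rfl⟩
      symm := fun {π ρ} ⟨U, hU⟩ => ⟨U.symm, fun g v => by
        apply U.injective
        rw [hU, U.apply_symm_apply, U.apply_symm_apply]⟩
      trans := fun {π ρ σ} ⟨U, hU⟩ ⟨V, hV⟩ => ⟨U.trans V, fun g v => by
        simp only [LinearIsometryEquiv.trans_apply, hU, hV]⟩ }

variable (G) in
/-- The unitary dual `Ĝ`: irreducible unitary representations up to unitary equivalence. -/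
def UnitaryDual : Type (u + 1) := Quotient (IrredUnitaryRep.setoid G)

/-- A chosen representative of a class in the unitary dual. The quantities used below (`dim` and
the Hilbert-Schmidt norms of Fourier coefficients) do not depend on this choice. -/
def UnitaryDual.rep (π : UnitaryDual G) : IrredUnitaryRep G := Quotient.out π

/-- The representation space `H_π`. -/
abbrev UnitaryDual.Space (π : UnitaryDual G) : Type u := π.rep.H

/-- The dimension `d_π` of `H_π` (finite when `G` is compact). -/
def UnitaryDual.dim (π : UnitaryDual G) : ℕ := Module.finrank ℂ π.Space

/-- The Hilbert-Schmidt norm `‖T‖ = (tr (|T|²))^{1/2} = (tr (T* T))^{1/2}` of an operator on a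
finite-dimensional Hilbert space. -/
def hsNorm {H : Type u} [NormedAddCommGroup H] [InnerProductSpace ℂ H] [CompleteSpace H]
    (T : H →L[ℂ] H) : ℝ :=
  Real.sqrt (LinearMap.trace ℂ H ((ContinuousLinearMap.adjoint T ∘L T : H →L[ℂ] H) : H →ₗ[ℂ] H)).re

/-- Families of operators `φ(π) ∈ B(H_π)`, `π ∈ Ĝ`. -/
abbrev OperatorFamily (G : Type u) [Group G] [TopologicalSpace G] : Type (u + 1) :=
  (π : UnitaryDual G) → (π.Space →L[ℂ] π.Space)

/-- The norm `(∑_{π ∈ Λ} d_π ‖φ(π)‖²)^{1/2}` of `ℓ²-⊕_{π ∈ Λ} B₂(H_π)`, with the value `∞`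
exactly for the families outside that space. -/
def l2Norm (Λ : Set (UnitaryDual G)) (φ : OperatorFamily G) : ℝ≥0∞ :=
  (∑' π : Λ, (π.1.dim : ℝ≥0∞) * ENNReal.ofReal (hsNorm (φ π.1)) ^ 2) ^ (1 / 2 : ℝ)

/-- Uniform `ℓ²-⊕ B₂(H_π)`-decay of a set of families of operators. -/
def HasUniformDecay (F : Set (OperatorFamily G)) : Prop :=
  ∀ ε : ℝ, 0 < ε → ∃ A : Finset (UnitaryDual G), ∀ φ ∈ F,
    l2Norm ((A : Set (UnitaryDual G))ᶜ) φ < ENNReal.ofReal ε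

/-- The Fourier transform `f̂(π) = ∫ f(t) π(t)* dμ(t)`. -/
def fourier [MeasurableSpace G] (μ : Measure G) (f : G → ℂ) : OperatorFamily G :=
  fun π => ∫ t, f t • ContinuousLinearMap.adjoint (π.rep.op t) ∂μ

end Dual

section Translation

variable {G : Type u} [Group G] [TopologicalSpace G] [IsTopologicalGroup G]
  [MeasurableSpace G] [BorelSpace G]

/-- A normalized Haar measure on a compact group is right invariant. -/
instance isMulRightInvariant_of_compact [CompactSpace G] (μ : Measure G) [μ.IsHaarMeasure]
    [IsProbabilityMeasure μ] : μ.IsMulRightInvariant where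
  map_mul_right_eq_self y := by
    have hm : Measurable fun x : G => x * y := measurable_mul_const y
    have : IsProbabilityMeasure (μ.map fun x => x * y) :=
      Measure.isProbabilityMeasure_map hm.aemeasurable
    exact Measure.isHaarMeasure_eq_of_isProbabilityMeasure _ _

/-- The right translation `(R_y f)(x) = f(xy)` on `L²(G)`. -/
def rightTranslate (μ : Measure G) [μ.IsMulRightInvariant] (y : G) (f : Lp ℂ 2 μ) : Lp ℂ 2 μ :=
  Lp.compMeasurePreserving (fun x => x * y) (measurePreserving_mul_right μ y) f

/-- Uniform `L²(G)`-equicontinuity of a subset of `L²(G)`. -/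
def UniformlyL2Equicontinuous (μ : Measure G) [μ.IsMulRightInvariant] (K : Set (Lp ℂ 2 μ)) :
    Prop :=
  ∀ ε : ℝ, 0 < ε → ∃ O : Set G, IsOpen O ∧ (1 : G) ∈ O ∧
    ∀ f ∈ K, ∀ y ∈ O, ‖rightTranslate μ y f - f‖ < ε

end Translation

end CompactGroup

end

/-! By Peter–Weyl (`orthogonal_span_normCoeff`) the functions `√d_π ⟨e_k, π(·) e_l⟩` form a Hilbert
basis of `L²(G)`. Plancherel then identifies the tail of `f̂` off a finite set `A` with the distance
from `f` to the finite-dimensional space `blockSpan μ A` (`l2Norm_compl_fourier`). So uniform decay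
means uniform approximability by such blocks (`hasUniformDecay_iff`), which for bounded `K` is total
boundedness. Compactness gives equicontinuity through a finite net, because translations are
isometries with continuous orbits.

Equicontinuity gives decay because averaging `R_y f` over a small neighbourhood of the identity
moves every `f ∈ K` only slightly. Replacing the normalized indicator by an `L²`-close combination
`ψ` of matrix coefficients costs a uniformly small error, as `K` is bounded
(`norm_conjIntegral_le`), and the new average lies in the block of `ψ`
(`conjIntegral_rightOrbit_mem_blockSpan`).

Peter–Weyl rests on averaging rank one operators over `G`. For a single representation this yields a
nonzero compact self-adjoint intertwiner, whose eigenspaces for nonzero eigenvalues are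
finite-dimensional and invariant; averages between two representations give Schur orthogonality. If
the orthogonal complement of the coefficients were nonzero, it would contain an irreducible
representation, whose vectors the Fubini identity `inner_innerFun_orbit` forces to vanish. -/

noncomputable section

set_option linter.unusedSectionVars false

namespace CompactGroup

/-! ### Algebra of unitary representations -/

section UnitaryHom

variable {G : Type*} [Group G] {H : Type*} [NormedAddCommGroup H] [InnerProductSpace ℂ H]
  [CompleteSpace H]

/-- A homomorphism into the bounded operators that preserves inner products takes unitary
values. -/
def unitaryHomOfInner (A : G →* (H →L[ℂ] H))
    (hA : ∀ g v w, inner ℂ (A g v) (A g w) = inner ℂ v w) :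
    G →* unitary (H →L[ℂ] H) where
  toFun g := ⟨A g, by
    have h : star (A g) = A g⁻¹ := by
      rw [ContinuousLinearMap.star_eq_adjoint, eq_comm, ContinuousLinearMap.eq_adjoint_iff]
      intro x y
      rw [← hA g, ← mul_apply_eq_comp, ← map_mul, mul_inv_cancel, map_one,
        one_apply_eq_self]
    rw [Unitary.mem_iff, h, ← map_mul, ← map_mul, inv_mul_cancel, mul_inv_cancel, map_one]
    exact ⟨rfl, rfl⟩⟩
  map_one' := Subtype.ext (map_one A)
  map_mul' g h := Subtype.ext (map_mul A g h)

variable (U : G →* unitary (H →L[ℂ] H))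

theorem unitaryHom_mul_apply (g h : G) (v : H) :
    (U (g * h) : H →L[ℂ] H) v = (U g : H →L[ℂ] H) ((U h : H →L[ℂ] H) v) := by
  rw [map_mul]; rfl

theorem unitaryHom_one_apply (v : H) : (U 1 : H →L[ℂ] H) v = v := by
  rw [map_one]; rfl

theorem inner_unitaryHom (g : G) (v w : H) :
    inner ℂ ((U g : H →L[ℂ] H) v) ((U g : H →L[ℂ] H) w) = inner ℂ v w := by
  rw [← ContinuousLinearMap.adjoint_inner_left, ← ContinuousLinearMap.star_eq_adjoint,
    ← mul_apply_eq_comp, Unitary.coe_star_mul_self, one_apply_eq_self]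

theorem inner_unitaryHom_right (g : G) (v w : H) :
    inner ℂ v ((U g : H →L[ℂ] H) w) = inner ℂ ((U g⁻¹ : H →L[ℂ] H) v) w := by
  rw [← inner_unitaryHom U g⁻¹, ← unitaryHom_mul_apply, inv_mul_cancel, unitaryHom_one_apply]

/-- The restriction of a unitary representation to a complete invariant subspace. -/
def restrictHom (W : Submodule ℂ H) [CompleteSpace W]
    (hW : ∀ g, ∀ v ∈ W, (U g : H →L[ℂ] H) v ∈ W) : G →* unitary (W →L[ℂ] W) :=
  unitaryHomOfInner
    { toFun := fun g => ((U g : H →L[ℂ] H) ∘L W.subtypeL).codRestrict W fun v => hW g v v.2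
      map_one' := by ext v; exact unitaryHom_one_apply U _
      map_mul' := fun g h => by ext v; exact unitaryHom_mul_apply U _ _ _ }
    fun g v w => inner_unitaryHom U g v w

end UnitaryHom

/-! ### Intertwiners obtained by Haar averaging -/

section Averaging

theorem integrable_of_continuous {G : Type*} [TopologicalSpace G] [CompactSpace G]
    [MeasurableSpace G] [BorelSpace G] (μ : Measure G) [IsFiniteMeasureOnCompacts μ]
    {E : Type*} [NormedAddCommGroup E] {f : G → E}
    (hf : Continuous f) : Integrable f μ :=
  hf.integrable_of_hasCompactSupport (HasCompactSupport.of_compactSpace f)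

variable {G : Type*} [Group G] [TopologicalSpace G] [IsTopologicalGroup G] [CompactSpace G]
  [MeasurableSpace G] [BorelSpace G] (μ : Measure G) [μ.IsHaarMeasure] [IsProbabilityMeasure μ]
  {H : Type*} [NormedAddCommGroup H] [InnerProductSpace ℂ H] [CompleteSpace H]
  {H₂ : Type*} [NormedAddCommGroup H₂] [InnerProductSpace ℂ H₂] [CompleteSpace H₂]
  (U : G →* unitary (H →L[ℂ] H)) (V : G →* unitary (H₂ →L[ℂ] H₂))

/-- The average over the group of the rank one operators `U(g) (a ⊗ b*) V(g)*`. -/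
def average (a : H) (b : H₂) : H₂ →L[ℂ] H :=
  ∫ g, InnerProductSpace.rankOne ℂ ((U g : H →L[ℂ] H) a) ((V g : H₂ →L[ℂ] H₂) b) ∂μ

variable {U V}

theorem continuous_rankOne (hU : ∀ v, Continuous fun g => (U g : H →L[ℂ] H) v)
    (hV : ∀ v, Continuous fun g => (V g : H₂ →L[ℂ] H₂) v)
    (a : H) (b : H₂) : Continuous fun g =>
    InnerProductSpace.rankOne ℂ ((U g : H →L[ℂ] H) a) ((V g : H₂ →L[ℂ] H₂) b) :=
  (ContinuousLinearMap.smulRightL ℂ H₂ H).continuous₂.comp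
    (((innerSL ℂ).continuous.comp (hV b)).prodMk (hU a))

theorem average_apply (hU : ∀ v, Continuous fun g => (U g : H →L[ℂ] H) v)
    (hV : ∀ v, Continuous fun g => (V g : H₂ →L[ℂ] H₂) v)
    (a : H) (b y : H₂) : average μ U V a b y =
    ∫ g, inner ℂ ((V g : H₂ →L[ℂ] H₂) b) y • (U g : H →L[ℂ] H) a ∂μ := by
  rw [average, ContinuousLinearMap.integral_apply
    (integrable_of_continuous μ (continuous_rankOne hU hV a b))]
  rfl

theorem inner_average (hU : ∀ v, Continuous fun g => (U g : H →L[ℂ] H) v)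
    (hV : ∀ v, Continuous fun g => (V g : H₂ →L[ℂ] H₂) v)
    (a x : H) (b y : H₂) : inner ℂ x (average μ U V a b y) =
    ∫ g, inner ℂ ((V g : H₂ →L[ℂ] H₂) b) y * inner ℂ x ((U g : H →L[ℂ] H) a) ∂μ := by
  rw [average_apply μ hU hV, ← integral_inner]
  · simp_rw [inner_smul_right]
  · exact integrable_of_continuous μ (((hV b).inner continuous_const).smul (hU a))

/-- Left invariance of Haar measure, used as the substitution `g ↦ hg` in the matrix entries. -/
theorem average_intertwines (hU : ∀ v, Continuous fun g => (U g : H →L[ℂ] H) v)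
    (hV : ∀ v, Continuous fun g => (V g : H₂ →L[ℂ] H₂) v)
    (a : H) (b y : H₂) (h : G) :
    (U h : H →L[ℂ] H) (average μ U V a b y) = average μ U V a b ((V h : H₂ →L[ℂ] H₂) y) := by
  refine ext_inner_left ℂ fun x => ?_
  rw [inner_unitaryHom_right, inner_average μ hU hV, inner_average μ hU hV, eq_comm,
    ← integral_mul_left_eq_self _ h]
  congr 1 with g
  rw [unitaryHom_mul_apply, unitaryHom_mul_apply, inner_unitaryHom, inner_unitaryHom_right U h]

/-- Compact operators form a closed convex set, which contains the mean of a norm-continuous family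
of rank one operators over a probability measure. -/
theorem isCompactOperator_average (hU : ∀ v, Continuous fun g => (U g : H →L[ℂ] H) v)
    (hV : ∀ v, Continuous fun g => (V g : H₂ →L[ℂ] H₂) v)
    (a : H) (b : H₂) : IsCompactOperator (average μ U V a b) := by
  have hc : Convex ℝ {T : H₂ →L[ℂ] H | IsCompactOperator T} := by
    intro S hS T hT p q _ _ _
    exact (hS.smul p).add (hT.smul q)
  refine hc.integral_mem isClosed_setOfPred_isCompactOperator (.of_forall fun g => ?_)
    (integrable_of_continuous μ (continuous_rankOne hU hV a b))
  have h : IsCompactOperator (ContinuousLinearMap.toSpanSingleton ℂ ((U g : H →L[ℂ] H) a)) :=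
    isCompactOperator_of_locallyCompactSpace_rng _
  exact h.comp_clm (innerSL ℂ ((V g : H₂ →L[ℂ] H₂) b))

theorem isSymmetric_average (hU : ∀ v, Continuous fun g => (U g : H →L[ℂ] H) v)
    (a : H) : (average μ U U a a : H →ₗ[ℂ] H).IsSymmetric := by
  intro x y
  rw [← inner_conj_symm]
  simp only [ContinuousLinearMap.coe_coe]
  rw [inner_average μ hU hU, inner_average μ hU hU, ← integral_conj]
  congr 1 with g
  rw [map_mul, inner_conj_symm, inner_conj_symm, mul_comm]

/-- The diagonal entry at `a` is `∫ |⟨a, U(g) a⟩|²`, whose integrand is continuous, nonnegative and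
positive at `g = 1`. -/
theorem average_ne_zero (hU : ∀ v, Continuous fun g => (U g : H →L[ℂ] H) v)
    {a : H} (ha : a ≠ 0) : average μ U U a a ≠ 0 := by
  intro h0
  have h := inner_average μ hU hU a a a a
  rw [h0, zero_apply, inner_zero_right] at h
  have hcont : Continuous fun g => ‖inner ℂ a ((U g : H →L[ℂ] H) a)‖ ^ 2 :=
    ((continuous_const.inner (hU a)).norm).pow 2
  have h2 : ∫ g, ‖inner ℂ a ((U g : H →L[ℂ] H) a)‖ ^ 2 ∂μ = 0 := by
    have : ((∫ g, ‖inner ℂ a ((U g : H →L[ℂ] H) a)‖ ^ 2 ∂μ : ℝ) : ℂ) = 0 := by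
      rw [h]
      refine integral_ofReal.symm.trans (integral_congr_ae (.of_forall fun g => ?_))
      beta_reduce
      rw [← inner_conj_symm ((U g : H →L[ℂ] H) a), ← Complex.normSq_eq_conj_mul_self,
        Complex.normSq_eq_norm_sq]
      rfl
    exact_mod_cast this
  have h3 := (hcont.integral_pos_of_hasCompactSupport_nonneg_nonzero (μ := μ)
    (HasCompactSupport.of_compactSpace _) (fun g => by positivity) (x := 1) ?_)
  · exact h3.ne' h2
  · rw [unitaryHom_one_apply]
    simpa using ha

end Averaging

/-- A nonzero strongly continuous unitary representation of a compact group has a nonzero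
finite-dimensional invariant subspace. -/
theorem exists_finiteDimensional_invariant {G : Type*} [Group G] [TopologicalSpace G]
    [IsTopologicalGroup G] [CompactSpace G] {H : Type*} [NormedAddCommGroup H]
    [InnerProductSpace ℂ H] [CompleteSpace H] {U : G →* unitary (H →L[ℂ] H)}
    (hU : ∀ v, Continuous fun g => (U g : H →L[ℂ] H) v) [Nontrivial H] : ∃ W : Submodule ℂ H,
    FiniteDimensional ℂ W ∧ W ≠ ⊥ ∧ ∀ g, ∀ v ∈ W, (U g : H →L[ℂ] H) v ∈ W := by
  borelize G
  let μ : Measure G := Measure.haarMeasure ⊤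
  have : IsProbabilityMeasure μ := ⟨by
    simpa using Measure.haarMeasure_self (K₀ := (⊤ : TopologicalSpace.PositiveCompacts G))⟩
  obtain ⟨a, ha⟩ := exists_ne (0 : H)
  have hcomp := isCompactOperator_average μ hU hU a a
  -- Spectral theorem: a compact self-adjoint operator with no nonzero eigenvalue is zero.
  have hex : ∃ c : ℂ, Module.End.HasEigenvalue (average μ U U a a : H →ₗ[ℂ] H) c ∧ c ≠ 0 := by
    by_contra! hcon
    exact average_ne_zero μ hU ha ((ContinuousLinearMap.eq_zero_of_forall_hasEigenvalue_eq_zero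
      hcomp (isSymmetric_average μ hU a)).1 hcon)
  obtain ⟨c, hc, hc0⟩ := hex
  refine ⟨Module.End.eigenspace _ c, ContinuousLinearMap.finite_dimensional_eigenspace hcomp c hc0, hc,
    fun g v hv => ?_⟩
  rw [Module.End.mem_eigenspace_iff] at hv ⊢
  have := average_intertwines μ hU hU a a v g
  simp only [ContinuousLinearMap.coe_coe] at hv ⊢
  rw [← this, hv, map_smul]

/-! ### Schur's lemma, irreducible subrepresentations and orthogonality of coefficients -/

section Irreducible

variable {G : Type u} [Group G] [TopologicalSpace G]

namespace IrredUnitaryRep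

variable (π ρ : IrredUnitaryRep G)

theorem continuous_op (v : π.H) : Continuous fun g => π.op g v := π.continuous_apply v

theorem op_mul_apply (g h : G) (v : π.H) : π.op (g * h) v = π.op g (π.op h v) :=
  unitaryHom_mul_apply π.toHom g h v

theorem inner_op_right (g : G) (v w : π.H) :
    inner ℂ v (π.op g w) = inner ℂ (π.op g⁻¹ v) w :=
  inner_unitaryHom_right π.toHom g v w

variable {π ρ}

/-- The matrix coefficient `g ↦ ⟨x, π(g) a⟩`. -/
def coeff (π : IrredUnitaryRep G) (x a : π.H) : C(G, ℂ) :=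
  ⟨fun g => inner ℂ x (π.op g a), continuous_const.inner (π.continuous_op a)⟩

theorem coeff_apply (π : IrredUnitaryRep G) (x a : π.H) (g : G) :
    π.coeff x a g = inner ℂ x (π.op g a) := rfl

/-- **Schur's lemma** for endomorphisms. -/
theorem exists_eq_smul_of_commute [FiniteDimensional ℂ π.H] (T : π.H →L[ℂ] π.H)
    (hT : ∀ g v, π.op g (T v) = T (π.op g v)) : ∃ c : ℂ, ∀ v, T v = c • v := by
  obtain ⟨c, hc⟩ := Module.End.exists_eigenvalue (T : π.H →ₗ[ℂ] π.H)
  refine ⟨c, fun v => ?_⟩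
  have h := (π.irreducible (Module.End.eigenspace (T : π.H →ₗ[ℂ] π.H) c)
    (Submodule.closed_of_finiteDimensional _) fun g w hw => ?_).resolve_left hc
  · have : v ∈ Module.End.eigenspace (T : π.H →ₗ[ℂ] π.H) c := h ▸ Submodule.mem_top
    exact Module.End.mem_eigenspace_iff.1 this
  · rw [Module.End.mem_eigenspace_iff] at hw ⊢
    change T w = c • w at hw
    change T (π.op g w) = c • π.op g w
    rw [← hT, hw, map_smul]

/-- **Schur's lemma**: intertwining operators between inequivalent representations vanish. -/
theorem eq_zero_of_intertwines [FiniteDimensional ℂ ρ.H]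
    (T : ρ.H →L[ℂ] π.H) (hT : ∀ g v, π.op g (T v) = T (ρ.op g v))
    (hne : ¬ ρ.UnitarilyEquivalent π) : T = 0 := by
  by_contra h0
  -- `T*T` commutes with `ρ`, so it is a scalar `r²` and `T / r` is an isometry. Its range is
  -- closed, invariant and nonzero, hence everything, which makes `T / r` a unitary equivalence.
  obtain ⟨c, hc⟩ := exists_eq_smul_of_commute (ContinuousLinearMap.adjoint T ∘L T) fun g v => by
    refine ext_inner_left ℂ fun x => ?_
    rw [inner_op_right, ContinuousLinearMap.comp_apply, ContinuousLinearMap.comp_apply,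
      ContinuousLinearMap.adjoint_inner_right, ContinuousLinearMap.adjoint_inner_right, ← hT, ← hT,
      inner_op_right]
  have hin (x y : ρ.H) : inner ℂ (T x) (T y) = c * inner ℂ x y := by
    rw [← ContinuousLinearMap.adjoint_inner_right, ← ContinuousLinearMap.comp_apply, hc,
      inner_smul_right]
  obtain ⟨w, hw⟩ : ∃ w, T w ≠ 0 := by
    by_contra! h
    exact h0 (ContinuousLinearMap.ext h)
  have hw0 : w ≠ 0 := fun h => hw (by rw [h, map_zero])
  obtain ⟨r, hr, rfl⟩ : ∃ r : ℝ, 0 < r ∧ c = (r : ℂ) ^ 2 := by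
    have h1 := hin w w
    rw [inner_self_eq_norm_sq_to_K, inner_self_eq_norm_sq_to_K] at h1
    have h2 : ((‖w‖ : ℝ) : ℂ) ≠ 0 := by simpa using hw0
    refine ⟨‖T w‖ / ‖w‖, div_pos (norm_pos_iff.2 hw) (norm_pos_iff.2 hw0), ?_⟩
    push_cast
    rw [div_pow, eq_div_iff (pow_ne_zero 2 h2)]
    exact h1.symm
  have hnorm (x : ρ.H) : ‖T x‖ = r * ‖x‖ := by
    have h1 := hin x x
    rw [inner_self_eq_norm_sq_to_K, inner_self_eq_norm_sq_to_K, ← mul_pow] at h1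
    have h2 : ‖T x‖ ^ 2 = (r * ‖x‖) ^ 2 := by
      apply Complex.ofReal_injective
      push_cast
      exact h1
    exact (sq_eq_sq₀ (norm_nonneg _) (by positivity)).1 h2
  let J : ρ.H →ₗᵢ[ℂ] π.H :=
    { toLinearMap := (((r : ℂ)⁻¹ • T : ρ.H →L[ℂ] π.H) : ρ.H →ₗ[ℂ] π.H)
      norm_map' := fun x => by
        change ‖(r : ℂ)⁻¹ • T x‖ = ‖x‖
        rw [norm_smul, hnorm, norm_inv, Complex.norm_real, Real.norm_of_nonneg hr.le,
          inv_mul_cancel_left₀ hr.ne'] }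
  have hJ (x : ρ.H) : J x = (r : ℂ)⁻¹ • T x := rfl
  have hinv (g : G) (x : ρ.H) : J (ρ.op g x) = π.op g (J x) := by
    rw [hJ, hJ, map_smul, hT]
  have hr0 : (r : ℂ) ≠ 0 := by exact_mod_cast hr.ne'
  have hsurj : LinearMap.range J.toLinearMap = ⊤ := by
    refine (π.irreducible _ J.isometry.isClosedEmbedding.isClosed_range ?_).resolve_left fun h => ?_
    · rintro g _ ⟨x, rfl⟩
      exact ⟨ρ.op g x, hinv g x⟩
    · have hmem : J w ∈ LinearMap.range J.toLinearMap := ⟨w, rfl⟩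
      rw [h, Submodule.mem_bot, hJ] at hmem
      exact (smul_ne_zero (inv_ne_zero hr0) hw) hmem
  exact hne ⟨LinearIsometryEquiv.ofSurjective J (LinearMap.range_eq_top.1 hsurj), hinv⟩

end IrredUnitaryRep

section Existence

variable [IsTopologicalGroup G] [CompactSpace G]

instance IrredUnitaryRep.finiteDimensional (π : IrredUnitaryRep G) : FiniteDimensional ℂ π.H := by
  obtain ⟨W, hW, hW0, hinv⟩ := exists_finiteDimensional_invariant π.continuous_apply
  have h := (π.irreducible W (Submodule.closed_of_finiteDimensional W) hinv).resolve_left hW0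
  subst h
  exact Module.Finite.equiv (Submodule.topEquiv : (⊤ : Submodule ℂ π.H) ≃ₗ[ℂ] π.H)

/-- Every nonzero strongly continuous unitary representation of a compact group contains an
irreducible one. -/
theorem exists_irreducible_subrepresentation {H : Type u} [NormedAddCommGroup H]
    [InnerProductSpace ℂ H] [CompleteSpace H] [Nontrivial H] {U : G →* unitary (H →L[ℂ] H)}
    (hU : ∀ v, Continuous fun g => (U g : H →L[ℂ] H) v) :
    ∃ (σ : IrredUnitaryRep G) (J : σ.H →ₗᵢ[ℂ] H),
      ∀ g v, J (σ.op g v) = (U g : H →L[ℂ] H) (J v) := by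
  classical
  -- A nonzero finite-dimensional invariant subspace of least dimension is irreducible.
  let P : ℕ → Prop := fun n => ∃ W : Submodule ℂ H, FiniteDimensional ℂ W ∧ W ≠ ⊥ ∧
    (∀ g, ∀ v ∈ W, (U g : H →L[ℂ] H) v ∈ W) ∧ Module.finrank ℂ W = n
  have hP : ∃ n, P n := by
    obtain ⟨W, hW, hW0, hinv⟩ := exists_finiteDimensional_invariant hU
    exact ⟨_, W, hW, hW0, hinv, rfl⟩
  obtain ⟨W, hW, hW0, hinv, hdim⟩ := Nat.find_spec hP
  have hmin : ∀ W' : Submodule ℂ H, W' ≤ W → W' ≠ ⊥ →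
      (∀ g, ∀ v ∈ W', (U g : H →L[ℂ] H) v ∈ W') → W' = W := by
    intro W' hle hne hinv'
    have hfin : FiniteDimensional ℂ W' := Submodule.finiteDimensional_of_le hle
    refine Submodule.eq_of_le_of_finrank_le hle ?_
    rw [hdim]
    exact Nat.find_min' hP ⟨W', hfin, hne, hinv', rfl⟩
  have : Nontrivial W := Submodule.nontrivial_iff_ne_bot.2 hW0
  have : CompleteSpace W := FiniteDimensional.complete ℂ W
  refine ⟨{ H := W
            toHom := restrictHom U W hinv
            continuous_apply := fun v => (hU v).subtype_mk _
            irreducible := fun M _ hM => ?_ }, W.subtypeₗᵢ, fun g v => rfl⟩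
  by_cases h0 : M = ⊥
  · exact Or.inl h0
  · right
    have h := hmin (M.map W.subtype) (Submodule.map_subtype_le W M)
      (fun h => h0 (Submodule.map_injective_of_injective W.subtype_injective
        (h.trans (Submodule.map_bot _).symm))) ?_
    · exact Submodule.map_injective_of_injective W.subtype_injective (by
        rw [h, Submodule.map_subtype_top])
    · rintro g _ ⟨v, hv, rfl⟩
      exact ⟨_, hM g v hv, rfl⟩

end Existence

section Coefficients

variable [IsTopologicalGroup G] [CompactSpace G] [MeasurableSpace G] [BorelSpace G]
  (μ : Measure G) [μ.IsHaarMeasure] [IsProbabilityMeasure μ]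

namespace IrredUnitaryRep

/-- The matrix coefficient as an element of `L²(G)`. -/
def coeffLp (π : IrredUnitaryRep G) (x a : π.H) : Lp ℂ 2 μ :=
  ContinuousMap.toLp 2 μ ℂ (π.coeff x a)

/-- This reduces the orthogonality relations to Schur's lemma for the averaged intertwiner. -/
theorem inner_coeffLp (π ρ : IrredUnitaryRep G) (x a : π.H) (y b : ρ.H) :
    inner ℂ (ρ.coeffLp μ y b) (π.coeffLp μ x a) =
      inner ℂ x (average μ π.toHom ρ.toHom a b y) := by
  rw [inner_average μ π.continuous_apply ρ.continuous_apply, coeffLp, coeffLp,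
    ContinuousMap.inner_toLp]
  congr 1 with g
  rw [coeff_apply, coeff_apply, inner_conj_symm, mul_comm]
  rfl

/-- **Schur orthogonality** for inequivalent representations. -/
theorem inner_coeffLp_eq_zero {π ρ : IrredUnitaryRep G} (h : ¬ ρ.UnitarilyEquivalent π)
    (x a : π.H) (y b : ρ.H) : inner ℂ (ρ.coeffLp μ y b) (π.coeffLp μ x a) = 0 := by
  rw [inner_coeffLp, eq_zero_of_intertwines (average μ π.toHom ρ.toHom a b) (fun g v =>
    average_intertwines μ π.continuous_apply ρ.continuous_apply a b v g) h, zero_apply,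
    inner_zero_right]

/-- **Schur orthogonality** for a single representation. -/
theorem finrank_mul_inner_coeffLp (π : IrredUnitaryRep G) (x a y b : π.H) :
    (Module.finrank ℂ π.H : ℂ) * inner ℂ (π.coeffLp μ y b) (π.coeffLp μ x a) =
      inner ℂ x y * inner ℂ b a := by
  obtain ⟨c, hc⟩ := exists_eq_smul_of_commute (average μ π.toHom π.toHom a b) fun g v =>
    average_intertwines μ π.continuous_apply π.continuous_apply a b v g
  let e := stdOrthonormalBasis ℂ π.H
  -- The scalar `c` is read off from the trace: by Parseval the integrand sums to `⟨π(g) b, π(g) a⟩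
  -- = ⟨b, a⟩`.
  have h : (Module.finrank ℂ π.H : ℂ) * c = inner ℂ b a := by
    have h1 : ∑ k, inner ℂ (e k) (average μ π.toHom π.toHom a b (e k)) =
        (Module.finrank ℂ π.H : ℂ) * c := by
      simp [hc]
    rw [← h1]
    simp_rw [inner_average μ π.continuous_apply π.continuous_apply]
    rw [← integral_finsetSum]
    · simp_rw [OrthonormalBasis.sum_inner_mul_inner, inner_unitaryHom]
      simp
    · intro k _
      exact integrable_of_continuous μ (((π.continuous_apply b).inner continuous_const).mul
        (continuous_const.inner (π.continuous_apply a)))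
  rw [inner_coeffLp, hc, inner_smul_right, ← h]
  ring

end IrredUnitaryRep

end Coefficients

end Irreducible

/-! ### Vector-valued integrals against an `L²` weight -/

section ConjIntegral

variable {G : Type*} [TopologicalSpace G] [CompactSpace G] [MeasurableSpace G] [BorelSpace G]
  (μ : Measure G) [IsProbabilityMeasure μ]
  {E : Type*} [NormedAddCommGroup E] [InnerProductSpace ℂ E]

/-- The vector-valued integral `∫ conj (ψ y) • F y`. -/
def conjIntegral (ψ : Lp ℂ 2 μ) (F : C(G, E)) : E := ∫ y, (starRingEnd ℂ) (ψ y) • F y ∂μ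

/-- The scalar function `y ↦ ⟨w, F y⟩`. -/
def innerFun (w : E) (F : C(G, E)) : C(G, ℂ) := ⟨fun y => inner ℂ w (F y), by fun_prop⟩

theorem integrable_conj_smul (ψ : Lp ℂ 2 μ) (F : C(G, E)) :
    Integrable (fun y => (starRingEnd ℂ) (ψ y) • F y) μ := by
  have h1 : Integrable ψ μ := (Lp.memLp ψ).integrable one_le_two
  have h2 : Integrable (fun y => (starRingEnd ℂ) (ψ y)) μ :=
    (Complex.conjCLE : ℂ →L[ℝ] ℂ).integrable_comp h1
  exact h2.smul_bdd ‖F‖ (integrable_of_continuous μ F.continuous).aestronglyMeasurable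
    (.of_forall F.norm_coe_le_norm)

variable [CompleteSpace E]

/-- Through this identity the vector-valued integral is handled entirely by scalar `L²` inner
products; the conjugate on `ψ` is what makes it exact. -/
theorem inner_conjIntegral (ψ : Lp ℂ 2 μ) (F : C(G, E)) (w : E) :
    inner ℂ w (conjIntegral μ ψ F) = inner ℂ ψ (ContinuousMap.toLp 2 μ ℂ (innerFun w F)) := by
  rw [conjIntegral, ← integral_inner (integrable_conj_smul μ ψ F), L2.inner_def]
  refine integral_congr_ae ?_
  filter_upwards [ContinuousMap.coeFn_toLp (p := 2) (𝕜 := ℂ) μ (innerFun w F)] with y hy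
  rw [hy, inner_smul_right, RCLike.inner_apply, mul_comm]
  rfl

theorem conjIntegral_sub_left (ψ φ : Lp ℂ 2 μ) (F : C(G, E)) :
    conjIntegral μ (ψ - φ) F = conjIntegral μ ψ F - conjIntegral μ φ F := by
  refine ext_inner_left ℂ fun w => ?_
  simp only [inner_sub_right, inner_conjIntegral, inner_sub_left]

theorem norm_toLp_le (f : C(G, ℂ)) : ‖ContinuousMap.toLp 2 μ ℂ f‖ ≤ ‖f‖ := by
  refine (ContinuousLinearMap.le_of_opNorm_le _ (ContinuousMap.toLp_norm_le μ) f).trans ?_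
  simp [measureUnivNNReal]

/-- Pair the integral with itself and apply Cauchy–Schwarz; on a probability space the `L²` norm is
at most the sup norm. -/
theorem norm_conjIntegral_le (ψ : Lp ℂ 2 μ) (F : C(G, E)) :
    ‖conjIntegral μ ψ F‖ ≤ ‖ψ‖ * ‖F‖ := by
  set I := conjIntegral μ ψ F with hI
  rcases eq_or_ne I 0 with h0 | h0
  · rw [h0, norm_zero]; positivity
  have h1 : ‖I‖ * ‖I‖ ≤ ‖ψ‖ * (‖I‖ * ‖F‖) := by
    have h2 : ‖inner ℂ I I‖ = ‖I‖ * ‖I‖ := by simp [inner_self_eq_norm_sq_to_K, sq]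
    rw [← h2]
    nth_rewrite 2 [hI]
    rw [inner_conjIntegral]
    refine (norm_inner_le_norm _ _).trans (mul_le_mul_of_nonneg_left ?_ (norm_nonneg _))
    refine (norm_toLp_le μ _).trans ((ContinuousMap.norm_le _ (by positivity)).2 fun y => ?_)
    exact (norm_inner_le_norm _ _).trans
      (mul_le_mul_of_nonneg_left (F.norm_coe_le_norm y) (norm_nonneg _))
  have h2 : 0 < ‖I‖ := norm_pos_iff.2 h0
  nlinarith

end ConjIntegral

/-! ### Left and right translations on `L²(G)` -/

section Translations

variable {G : Type u} [Group G] [TopologicalSpace G] [IsTopologicalGroup G] [CompactSpace G]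
  [MeasurableSpace G] [BorelSpace G] (μ : Measure G) [μ.IsHaarMeasure]
  [IsProbabilityMeasure μ]

/-- The left translation `f ↦ (x ↦ f(yx))` on `L²(G)`. -/
def leftTranslate (y : G) (f : Lp ℂ 2 μ) : Lp ℂ 2 μ :=
  Lp.compMeasurePreserving (fun x => y * x) (measurePreserving_mul_left μ y) f

/-- The orbit map `y ↦ R_y f`, as a continuous function of `f`. -/
def rightOrbit : C(Lp ℂ 2 μ, C(G, Lp ℂ 2 μ)) :=
  ContinuousMap.curry ⟨fun p => rightTranslate μ p.2 p.1,
    continuous_fst.compMeasurePreservingLp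
      (ContinuousMap.curry (⟨fun q => q.2 * q.1.2, by fun_prop⟩ :
        C((Lp ℂ 2 μ × G) × G, G))).continuous
      (fun p => measurePreserving_mul_right μ p.2) (by simp)⟩

/-- The orbit map of the left translations, as a continuous function of `f`. -/
def leftOrbit : C(Lp ℂ 2 μ, C(G, Lp ℂ 2 μ)) :=
  ContinuousMap.curry ⟨fun p => leftTranslate μ p.2 p.1,
    continuous_fst.compMeasurePreservingLp
      (ContinuousMap.curry (⟨fun q => q.1.2 * q.2, by fun_prop⟩ :
        C((Lp ℂ 2 μ × G) × G, G))).continuous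
      (fun p => measurePreserving_mul_left μ p.2) (by simp)⟩

theorem rightOrbit_apply (f : Lp ℂ 2 μ) (y : G) : rightOrbit μ f y = rightTranslate μ y f := rfl

theorem norm_rightTranslate (y : G) (f : Lp ℂ 2 μ) : ‖rightTranslate μ y f‖ = ‖f‖ :=
  Lp.norm_compMeasurePreserving f _

theorem rightTranslate_sub (y : G) (f g : Lp ℂ 2 μ) :
    rightTranslate μ y (f - g) = rightTranslate μ y f - rightTranslate μ y g :=
  map_sub (Lp.compMeasurePreserving _ (measurePreserving_mul_right μ y)) f g

theorem rightTranslate_one (f : Lp ℂ 2 μ) : rightTranslate μ 1 f = f := by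
  simp only [rightTranslate, mul_one]
  exact Lp.compMeasurePreserving_id_apply f

theorem leftTranslate_one (f : Lp ℂ 2 μ) : leftTranslate μ 1 f = f := by
  simp only [leftTranslate, one_mul]
  exact Lp.compMeasurePreserving_id_apply f

theorem rightTranslate_mul (y z : G) (f : Lp ℂ 2 μ) :
    rightTranslate μ (y * z) f = rightTranslate μ y (rightTranslate μ z f) := by
  simp only [rightTranslate, ← mul_assoc]
  exact Lp.compMeasurePreserving_comp_apply f (measurePreserving_mul_right μ z)
    (measurePreserving_mul_right μ y)

theorem leftTranslate_mul (y z : G) (f : Lp ℂ 2 μ) :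
    leftTranslate μ (y * z) f = leftTranslate μ z (leftTranslate μ y f) := by
  simp only [leftTranslate, mul_assoc]
  exact Lp.compMeasurePreserving_comp_apply f (measurePreserving_mul_left μ y)
    (measurePreserving_mul_left μ z)

theorem inner_leftTranslate (y : G) (f g : Lp ℂ 2 μ) :
    inner ℂ (leftTranslate μ y f) (leftTranslate μ y g) = inner ℂ f g :=
  (Lp.compMeasurePreservingₗᵢ ℂ _ (measurePreserving_mul_left μ y)).inner_map_map f g

theorem inner_leftTranslate_right (y : G) (f g : Lp ℂ 2 μ) :
    inner ℂ f (leftTranslate μ y g) = inner ℂ (leftTranslate μ y⁻¹ f) g := by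
  rw [← inner_leftTranslate μ y⁻¹, ← leftTranslate_mul, mul_inv_cancel, leftTranslate_one]

theorem rightTranslate_toLp (y : G) (f : C(G, ℂ)) :
    rightTranslate μ y (ContinuousMap.toLp 2 μ ℂ f) =
      ContinuousMap.toLp 2 μ ℂ (f.comp ⟨fun x => x * y, by fun_prop⟩) := rfl

theorem leftTranslate_toLp (y : G) (f : C(G, ℂ)) :
    leftTranslate μ y (ContinuousMap.toLp 2 μ ℂ f) =
      ContinuousMap.toLp 2 μ ℂ (f.comp ⟨fun x => y * x, by fun_prop⟩) := rfl

/-- The right regular representation. -/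
def rightRegular : G →* unitary (Lp ℂ 2 μ →L[ℂ] Lp ℂ 2 μ) :=
  unitaryHomOfInner
    { toFun := fun y => (Lp.compMeasurePreservingₗᵢ ℂ _
        (measurePreserving_mul_right μ y)).toContinuousLinearMap
      map_one' := by ext1 f; exact rightTranslate_one μ f
      map_mul' := fun y z => by ext1 f; exact rightTranslate_mul μ y z f }
    fun y f g => (Lp.compMeasurePreservingₗᵢ ℂ _ (measurePreserving_mul_right μ y)).inner_map_map f g

theorem rightRegular_apply (y : G) (f : Lp ℂ 2 μ) :
    (rightRegular μ y : Lp ℂ 2 μ →L[ℂ] Lp ℂ 2 μ) f = rightTranslate μ y f := rfl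

theorem continuous_innerFun_rightOrbit (w : Lp ℂ 2 μ) : Continuous fun v : Lp ℂ 2 μ =>
    ContinuousMap.toLp 2 μ ℂ (innerFun w (rightOrbit μ v)) :=
  (ContinuousMap.toLp 2 μ ℂ).continuous.comp
    ((ContinuousMap.continuous_postcomp ⟨fun x => inner ℂ w x, by fun_prop⟩).comp
      (rightOrbit μ).continuous)

theorem continuous_innerFun_leftOrbit (w : Lp ℂ 2 μ) : Continuous fun v : Lp ℂ 2 μ =>
    ContinuousMap.toLp 2 μ ℂ (innerFun w (leftOrbit μ v)) :=
  (ContinuousMap.toLp 2 μ ℂ).continuous.comp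
    ((ContinuousMap.continuous_postcomp ⟨fun x => inner ℂ w x, by fun_prop⟩).comp
      (leftOrbit μ).continuous)

theorem inner_innerFun_orbit_of_continuous (ψ w v : C(G, ℂ)) :
    inner ℂ (ContinuousMap.toLp 2 μ ℂ ψ) (ContinuousMap.toLp 2 μ ℂ
      (innerFun (ContinuousMap.toLp 2 μ ℂ w) (leftOrbit μ (ContinuousMap.toLp 2 μ ℂ v)))) =
    inner ℂ (ContinuousMap.toLp 2 μ ℂ w) (ContinuousMap.toLp 2 μ ℂ
      (innerFun (ContinuousMap.toLp 2 μ ℂ ψ) (rightOrbit μ (ContinuousMap.toLp 2 μ ℂ v)))) := by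
  rw [ContinuousMap.inner_toLp, ContinuousMap.inner_toLp]
  have hL (y : G) : innerFun (ContinuousMap.toLp 2 μ ℂ w)
      (leftOrbit μ (ContinuousMap.toLp 2 μ ℂ v)) y =
      ∫ x, v (y * x) * (starRingEnd ℂ) (w x) ∂μ := by
    change inner ℂ _ (leftTranslate μ y (ContinuousMap.toLp 2 μ ℂ v)) = _
    rw [leftTranslate_toLp, ContinuousMap.inner_toLp]
    rfl
  have hR (x : G) : innerFun (ContinuousMap.toLp 2 μ ℂ ψ)
      (rightOrbit μ (ContinuousMap.toLp 2 μ ℂ v)) x =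
      ∫ y, v (y * x) * (starRingEnd ℂ) (ψ y) ∂μ := by
    change inner ℂ _ (rightTranslate μ x (ContinuousMap.toLp 2 μ ℂ v)) = _
    rw [rightTranslate_toLp, ContinuousMap.inner_toLp]
    rfl
  simp_rw [hL, hR, ← integral_mul_const]
  rw [integral_integral_swap_of_hasCompactSupport
    (f := fun y x => v (y * x) * (starRingEnd ℂ) (w x) * (starRingEnd ℂ) (ψ y))
    (by simp only [Function.uncurry_def]; fun_prop) (HasCompactSupport.of_compactSpace _)]
  simp_rw [mul_right_comm]

/-- Fubini's theorem for the trilinear form `∬ conj (ψ y) conj (w x) v(yx)`. -/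
theorem inner_innerFun_orbit (ψ w v : Lp ℂ 2 μ) :
    inner ℂ ψ (ContinuousMap.toLp 2 μ ℂ (innerFun w (leftOrbit μ v))) =
      inner ℂ w (ContinuousMap.toLp 2 μ ℂ (innerFun ψ (rightOrbit μ v))) := by
  have hd : DenseRange (ContinuousMap.toLp 2 μ ℂ : C(G, ℂ) →L[ℂ] Lp ℂ 2 μ) :=
    ContinuousMap.toLp_denseRange ℂ μ ℂ (by simp)
  induction v using hd.induction_on with
  | hp =>
    exact isClosed_eq (continuous_const.inner (continuous_innerFun_leftOrbit μ w))
      (continuous_const.inner (continuous_innerFun_rightOrbit μ ψ))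
  | ih v =>
  induction w using hd.induction_on with
  | hp =>
    -- `inner_conjIntegral` trades the occurrence of `w` inside `innerFun` for one in a slot of the
    -- inner product, where continuity is evident.
    simp_rw [← inner_conjIntegral]
    refine isClosed_eq (continuous_id.inner continuous_const) ?_
    simp_rw [inner_conjIntegral]
    exact continuous_id.inner continuous_const
  | ih w =>
  induction ψ using hd.induction_on with
  | hp =>
    refine isClosed_eq (continuous_id.inner continuous_const) ?_
    simp_rw [← inner_conjIntegral]
    exact continuous_id.inner continuous_const
  | ih ψ => exact inner_innerFun_orbit_of_continuous μ ψ w v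

end Translations

/-! ### The Peter–Weyl theorem -/

section PeterWeyl

variable {G : Type u} [Group G] [TopologicalSpace G] [IsTopologicalGroup G] [CompactSpace G]
  [MeasurableSpace G] [BorelSpace G] (μ : Measure G) [μ.IsHaarMeasure] [IsProbabilityMeasure μ]

/-- An orthonormal basis of the representation space. -/
def UnitaryDual.basis (π : UnitaryDual G) : OrthonormalBasis (Fin π.dim) ℂ π.Space :=
  stdOrthonormalBasis ℂ π.Space

variable (G) in
/-- The index set of the normalized matrix coefficients. -/
abbrev CoeffIndex : Type (u + 1) := Σ π : UnitaryDual G, Fin π.dim × Fin π.dim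

/-- The normalized matrix coefficients `√d_π ⟨e_k, π(·) e_l⟩`. -/
def normCoeff (i : CoeffIndex G) : Lp ℂ 2 μ :=
  ((Real.sqrt i.1.dim : ℝ) : ℂ) • i.1.rep.coeffLp μ (i.1.basis i.2.1) (i.1.basis i.2.2)

theorem UnitaryDual.dim_pos (π : UnitaryDual G) : 0 < π.dim := Module.finrank_pos

theorem UnitaryDual.eq_of_rep_equivalent {π ρ : UnitaryDual G}
    (h : π.rep.UnitarilyEquivalent ρ.rep) : π = ρ :=
  Quotient.out_equiv_out.1 h

theorem ofReal_sqrt_mul_self (n : ℕ) :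
    ((Real.sqrt n : ℝ) : ℂ) * ((Real.sqrt n : ℝ) : ℂ) = n := by
  rw [← Complex.ofReal_mul, Real.mul_self_sqrt (Nat.cast_nonneg n), Complex.ofReal_natCast]

/-- The normalized matrix coefficients are orthonormal. -/
theorem orthonormal_normCoeff : Orthonormal ℂ (normCoeff μ : CoeffIndex G → Lp ℂ 2 μ) := by
  classical
  rw [orthonormal_iff_ite]
  rintro ⟨π, k, l⟩ ⟨ρ, m, n⟩
  by_cases hπ : π = ρ
  · subst hπ
    rw [normCoeff, normCoeff, inner_smul_left, inner_smul_right, Complex.conj_ofReal, ← mul_assoc]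
    dsimp only
    rw [ofReal_sqrt_mul_self]
    refine (π.rep.finrank_mul_inner_coeffLp μ _ _ _ _).trans ?_
    rw [orthonormal_iff_ite.1 π.basis.orthonormal, orthonormal_iff_ite.1 π.basis.orthonormal]
    by_cases h1 : k = m <;> by_cases h2 : l = n <;> simp [h1, h2, Ne.symm]
  · rw [normCoeff, normCoeff, inner_smul_left, inner_smul_right,
      IrredUnitaryRep.inner_coeffLp_eq_zero μ fun h => hπ (UnitaryDual.eq_of_rep_equivalent h),
      if_neg (by rintro ⟨⟩; exact hπ rfl), mul_zero, mul_zero]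

/-- The span of the matrix coefficients of the representations in a finite set. -/
def blockSpan (A : Finset (UnitaryDual G)) : Submodule ℂ (Lp ℂ 2 μ) :=
  Submodule.span ℂ (normCoeff μ '' ((A.sigma fun _ => Finset.univ : Finset (CoeffIndex G)) :
    Set (CoeffIndex G)))

instance (A : Finset (UnitaryDual G)) : FiniteDimensional ℂ (blockSpan μ A) :=
  FiniteDimensional.span_of_finite ℂ ((Finset.finite_toSet _).image _)

theorem blockSpan_mono {A B : Finset (UnitaryDual G)} (h : A ⊆ B) :
    blockSpan μ A ≤ blockSpan μ B :=
  Submodule.span_mono (Set.image_mono (Finset.coe_subset.2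
    (Finset.sigma_mono h fun _ => Finset.Subset.refl _)))

theorem normCoeff_mem_blockSpan {A : Finset (UnitaryDual G)} {i : CoeffIndex G} (hi : i.1 ∈ A) :
    normCoeff μ i ∈ blockSpan μ A :=
  Submodule.subset_span ⟨i, by simpa using hi, rfl⟩

theorem blockSpan_le_span_range (A : Finset (UnitaryDual G)) :
    blockSpan μ A ≤ Submodule.span ℂ (Set.range (normCoeff μ)) :=
  Submodule.span_mono (Set.image_subset_range _ _)

theorem IrredUnitaryRep.coeff_eq_sum (π : IrredUnitaryRep G) {ι : Type*} [Fintype ι]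
    (e : OrthonormalBasis ι ℂ π.H) (x a : π.H) :
    π.coeff x a = ∑ k, ∑ l, (inner ℂ x (e k) * inner ℂ (e l) a) • π.coeff (e k) (e l) := by
  ext g
  simp only [ContinuousMap.sum_apply, ContinuousMap.smul_apply, coeff_apply, smul_eq_mul]
  rw [← e.sum_inner_mul_inner x]
  refine Finset.sum_congr rfl fun k _ => ?_
  conv_lhs => rw [← e.sum_repr a]
  simp only [map_sum, map_smul, inner_sum, inner_smul_right, e.repr_apply_apply, Finset.mul_sum,
    mul_assoc]

theorem coeffLp_mem_blockSpan {A : Finset (UnitaryDual G)} {π : UnitaryDual G} (hπ : π ∈ A)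
    (x a : π.Space) : π.rep.coeffLp μ x a ∈ blockSpan μ A := by
  rw [IrredUnitaryRep.coeffLp, π.rep.coeff_eq_sum π.basis]
  simp only [map_sum, map_smul]
  refine Submodule.sum_mem _ fun k _ => Submodule.sum_mem _ fun l _ => Submodule.smul_mem _ _ ?_
  have h := normCoeff_mem_blockSpan μ (i := ⟨π, k, l⟩) hπ
  have h0 : ((Real.sqrt π.dim : ℝ) : ℂ) ≠ 0 := by
    have := π.dim_pos
    exact_mod_cast (Real.sqrt_pos.2 (by exact_mod_cast this)).ne'
  exact (Submodule.smul_mem_iff _ h0).1 h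

/-- A unitary equivalence carries coefficients to coefficients, so the chosen representatives of
classes suffice. -/
theorem coeffLp_mem_span_range (σ : IrredUnitaryRep G) (x a : σ.H) :
    σ.coeffLp μ x a ∈ Submodule.span ℂ (Set.range (normCoeff μ)) := by
  let π : UnitaryDual G := Quotient.mk (IrredUnitaryRep.setoid G) σ
  obtain ⟨U, hU⟩ : σ.UnitarilyEquivalent π.rep :=
    (IrredUnitaryRep.setoid G).symm (Quotient.mk_out (s := IrredUnitaryRep.setoid G) σ)
  have h : σ.coeff x a = π.rep.coeff (U x) (U a) := by
    ext g
    rw [IrredUnitaryRep.coeff_apply, IrredUnitaryRep.coeff_apply, ← hU, U.inner_map_map]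
  rw [IrredUnitaryRep.coeffLp, h]
  exact blockSpan_le_span_range μ {π} (coeffLp_mem_blockSpan μ (Finset.mem_singleton_self π) _ _)

theorem rightTranslate_coeffLp (σ : IrredUnitaryRep G) (x a : σ.H) (y : G) :
    rightTranslate μ y (σ.coeffLp μ x a) = σ.coeffLp μ x (σ.op y a) := by
  rw [IrredUnitaryRep.coeffLp, rightTranslate_toLp, IrredUnitaryRep.coeffLp]
  congr 1
  ext g
  exact congrArg (inner ℂ x) (σ.op_mul_apply g y a)

theorem leftTranslate_coeffLp (σ : IrredUnitaryRep G) (x a : σ.H) (y : G) :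
    leftTranslate μ y⁻¹ (σ.coeffLp μ x a) = σ.coeffLp μ (σ.op y x) a := by
  rw [IrredUnitaryRep.coeffLp, leftTranslate_toLp, IrredUnitaryRep.coeffLp]
  congr 1
  ext g
  change inner ℂ x (σ.op (y⁻¹ * g) a) = inner ℂ (σ.op y x) (σ.op g a)
  rw [σ.op_mul_apply, σ.inner_op_right, inv_inv]

theorem rightTranslate_mem_orthogonal {w : Lp ℂ 2 μ}
    (hw : w ∈ (Submodule.span ℂ (Set.range (normCoeff μ)))ᗮ) (y : G) :
    rightTranslate μ y w ∈ (Submodule.span ℂ (Set.range (normCoeff μ)))ᗮ := by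
  rw [Submodule.mem_orthogonal] at hw ⊢
  intro u hu
  rw [← rightRegular_apply, inner_unitaryHom_right]
  refine hw _ ?_
  induction hu using Submodule.span_induction with
  | mem u hu =>
    obtain ⟨i, rfl⟩ := hu
    rw [normCoeff, map_smul, rightRegular_apply, rightTranslate_coeffLp]
    exact Submodule.smul_mem _ _ (coeffLp_mem_span_range μ _ _ _)
  | zero => rw [map_zero]; exact Submodule.zero_mem _
  | add u v _ _ hu hv => rw [map_add]; exact Submodule.add_mem _ hu hv
  | smul c u _ hu => rw [map_smul]; exact Submodule.smul_mem _ _ hu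

/-- The **Peter-Weyl theorem**: the matrix coefficients are total in `L²(G)`. -/
theorem orthogonal_span_normCoeff :
    (Submodule.span ℂ (Set.range (normCoeff μ : CoeffIndex G → Lp ℂ 2 μ)))ᗮ = ⊥ := by
  set M := Submodule.span ℂ (Set.range (normCoeff μ : CoeffIndex G → Lp ℂ 2 μ)) with hM
  by_contra hne
  have : Nontrivial Mᗮ := Submodule.nontrivial_iff_ne_bot.2 hne
  have hinv : ∀ g, ∀ v ∈ Mᗮ, (rightRegular μ g : Lp ℂ 2 μ →L[ℂ] Lp ℂ 2 μ) v ∈ Mᗮ :=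
    fun g v hv => rightTranslate_mem_orthogonal μ hv g
  obtain ⟨σ, J, hJ⟩ := exists_irreducible_subrepresentation
    (U := restrictHom (rightRegular μ) Mᗮ hinv)
    fun v => (rightOrbit μ v).continuous.subtype_mk _
  let J' : σ.H →L[ℂ] Lp ℂ 2 μ := Mᗮ.subtypeL ∘L J.toContinuousLinearMap
  have hJ' (g : G) (s : σ.H) : J' (σ.op g s) = rightTranslate μ g (J' s) :=
    congrArg Subtype.val (hJ g s)
  obtain ⟨s, hs⟩ := exists_ne (0 : σ.H)
  have hv : J' s ∈ Mᗮ := (J s).2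
  -- With `v = J' s`, Fubini turns the pairing of `y ↦ ⟨v, L_y v⟩` with any `ψ` into the pairing of
  -- `v` with a coefficient of `σ`, which is zero as `v ∈ Mᗮ`. This continuous function therefore
  -- vanishes everywhere, and its value at `1` is `‖v‖²`.
  have hF : ContinuousMap.toLp 2 μ ℂ (innerFun (J' s) (leftOrbit μ (J' s))) = 0 := by
    refine ext_inner_left ℂ fun ψ => ?_
    rw [inner_innerFun_orbit, inner_zero_right]
    have h : innerFun ψ (rightOrbit μ (J' s)) =
        σ.coeff (ContinuousLinearMap.adjoint J' ψ) s := by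
      ext g
      change inner ℂ ψ (rightTranslate μ g (J' s)) = inner ℂ _ (σ.op g s)
      rw [ContinuousLinearMap.adjoint_inner_left, hJ']
    rw [h]
    exact Submodule.inner_left_of_mem_orthogonal (coeffLp_mem_span_range μ σ _ _) hv
  have hF0 := ContinuousMap.toLp_injective μ (hF.trans (map_zero _).symm)
  have h1 : inner ℂ (J' s) (leftTranslate μ 1 (J' s)) = 0 := congrArg (fun f => f 1) hF0
  rw [leftTranslate_one, inner_self_eq_zero] at h1
  refine hs (J.injective (Subtype.ext ?_))
  rw [map_zero]
  exact h1

/-- The Hilbert basis of normalized matrix coefficients. -/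
def coeffHilbertBasis : HilbertBasis (CoeffIndex G) ℂ (Lp ℂ 2 μ) :=
  HilbertBasis.mkOfOrthogonalEqBot (orthonormal_normCoeff μ) (orthogonal_span_normCoeff μ)

theorem coe_coeffHilbertBasis : ⇑(coeffHilbertBasis μ) = normCoeff (G := G) μ :=
  HilbertBasis.coe_mkOfOrthogonalEqBot _ _

theorem exists_mem_blockSpan_norm_sub_lt (f : Lp ℂ 2 μ) {ε : ℝ} (hε : 0 < ε) :
    ∃ A : Finset (UnitaryDual G), ∃ m ∈ blockSpan μ A, ‖f - m‖ < ε := by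
  classical
  have hd := (coeffHilbertBasis μ).dense_span
  rw [coe_coeffHilbertBasis] at hd
  have hf : f ∈ (Submodule.span ℂ (Set.range (normCoeff (G := G) μ))).topologicalClosure :=
    hd ▸ Submodule.mem_top
  obtain ⟨m, hm, hfm⟩ := Metric.mem_closure_iff.1 hf ε hε
  rw [dist_eq_norm] at hfm
  suffices ∃ A : Finset (UnitaryDual G), m ∈ blockSpan μ A from
    this.imp fun A hA => ⟨m, hA, hfm⟩
  clear hfm
  induction hm using Submodule.span_induction with
  | mem m hm =>
    obtain ⟨i, rfl⟩ := hm
    exact ⟨{i.1}, normCoeff_mem_blockSpan μ (Finset.mem_singleton_self _)⟩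
  | zero => exact ⟨∅, Submodule.zero_mem _⟩
  | add u v _ _ hu hv =>
    obtain ⟨A, hA⟩ := hu
    obtain ⟨B, hB⟩ := hv
    exact ⟨A ∪ B, Submodule.add_mem _ (blockSpan_mono μ Finset.subset_union_left hA)
      (blockSpan_mono μ Finset.subset_union_right hB)⟩
  | smul c u _ hu => exact hu.imp fun A hA => Submodule.smul_mem _ _ hA

end PeterWeyl

/-! ### Plancherel's theorem and uniform decay as approximation -/

section Plancherel

variable {G : Type u} [Group G] [TopologicalSpace G] [IsTopologicalGroup G] [CompactSpace G]
  [MeasurableSpace G] [BorelSpace G] (μ : Measure G) [μ.IsHaarMeasure] [IsProbabilityMeasure μ]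

theorem hsNorm_sq {H : Type u} [NormedAddCommGroup H] [InnerProductSpace ℂ H] [CompleteSpace H]
    {ι : Type*} [Fintype ι] (e : OrthonormalBasis ι ℂ H) (T : H →L[ℂ] H) :
    hsNorm T ^ 2 = ∑ l, ∑ k, ‖inner ℂ (e l) (T (e k))‖ ^ 2 := by
  have h : (LinearMap.trace ℂ H ((ContinuousLinearMap.adjoint T ∘L T : H →L[ℂ] H) :
      H →ₗ[ℂ] H)).re = ∑ k, ‖T (e k)‖ ^ 2 := by
    rw [LinearMap.trace_eq_sum_inner _ e, Complex.re_sum]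
    refine Finset.sum_congr rfl fun k _ => ?_
    rw [ContinuousLinearMap.coe_coe, ContinuousLinearMap.comp_apply,
      ContinuousLinearMap.adjoint_inner_right]
    exact inner_self_eq_norm_sq (𝕜 := ℂ) _
  rw [hsNorm, h, Real.sq_sqrt (Finset.sum_nonneg fun k _ => by positivity), Finset.sum_comm]
  simp_rw [e.sum_sq_norm_inner_right]

/-- Matrix entries of `f̂(π)` are the coordinates of `f` along matrix coefficients; the adjoint in
the transform swaps the two vectors. -/
theorem inner_fourier (f : Lp ℂ 2 μ) (π : UnitaryDual G) (x y : π.Space) :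
    inner ℂ x (fourier μ f π y) = inner ℂ (π.rep.coeffLp μ y x) f := by
  have hcont : Continuous fun t => ContinuousLinearMap.adjoint (π.rep.op t) := by
    refine (ContinuousLinearMap.adjoint (𝕜 := ℂ) (E := π.Space) (F := π.Space)).continuous.comp ?_
    exact continuous_clm_apply.2 π.rep.continuous_op
  have hfi : Integrable (fun t => f t • ContinuousLinearMap.adjoint (π.rep.op t)) μ := by
    have h1 : Integrable f μ := (Lp.memLp f).integrable one_le_two
    let F : C(G, π.Space →L[ℂ] π.Space) := ⟨_, hcont⟩
    exact h1.smul_bdd ‖F‖ (integrable_of_continuous μ F.continuous).aestronglyMeasurable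
      (.of_forall F.norm_coe_le_norm)
  rw [fourier, ContinuousLinearMap.integral_apply hfi,
    ← integral_inner (hfi.apply_continuousLinearMap y),
    L2.inner_def]
  refine integral_congr_ae ?_
  filter_upwards [ContinuousMap.coeFn_toLp (p := 2) (𝕜 := ℂ) μ (π.rep.coeff y x)] with t ht
  rw [IrredUnitaryRep.coeffLp, ht, smul_apply, inner_smul_right,
    ContinuousLinearMap.adjoint_inner_right, RCLike.inner_apply, IrredUnitaryRep.coeff_apply,
    inner_conj_symm]

theorem dim_mul_hsNorm_fourier_sq (f : Lp ℂ 2 μ) (π : UnitaryDual G) :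
    (π.dim : ℝ≥0∞) * ENNReal.ofReal (hsNorm (fourier μ f π)) ^ 2 =
      ∑' p : Fin π.dim × Fin π.dim, ENNReal.ofReal (‖inner ℂ (normCoeff μ ⟨π, p⟩) f‖ ^ 2) := by
  rw [tsum_fintype, ← ENNReal.ofReal_sum_of_nonneg fun _ _ => by positivity,
    ← ENNReal.ofReal_pow (by exact Real.sqrt_nonneg _), ← ENNReal.ofReal_natCast,
    ← ENNReal.ofReal_mul (Nat.cast_nonneg _), hsNorm_sq π.basis, Fintype.sum_prod_type_right]
  simp_rw [Finset.mul_sum]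
  congr 1
  refine Finset.sum_congr rfl fun l _ => Finset.sum_congr rfl fun k _ => ?_
  rw [normCoeff, inner_smul_left, inner_fourier, norm_mul, mul_pow, Complex.conj_ofReal,
    Complex.norm_real, Real.norm_of_nonneg (Real.sqrt_nonneg _), Real.sq_sqrt (Nat.cast_nonneg _)]

theorem tsum_normCoeff_inner_sq (f : Lp ℂ 2 μ) :
    ∑' i : CoeffIndex G, ENNReal.ofReal (‖inner ℂ (normCoeff μ i) f‖ ^ 2) =
      ENNReal.ofReal (‖f‖ ^ 2) := by
  have h := (coeffHilbertBasis μ).hasSum_inner_mul_inner f f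
  rw [coe_coeffHilbertBasis] at h
  have h2 : HasSum (fun i : CoeffIndex G => ‖inner ℂ (normCoeff μ i) f‖ ^ 2) (‖f‖ ^ 2) := by
    have h3 := Complex.reCLM.hasSum h
    convert h3 using 1
    · ext i
      rw [← inner_conj_symm f, Complex.reCLM_apply,
        ← Complex.normSq_eq_conj_mul_self, Complex.ofReal_re, Complex.normSq_eq_norm_sq]
    · exact (inner_self_eq_norm_sq (𝕜 := ℂ) f).symm
  rw [← h2.tsum_eq, ENNReal.ofReal_tsum_of_nonneg (fun _ => by positivity) h2.summable]

/-- **Plancherel's theorem** for the tails: the norm of the Fourier transform off a finite set `A`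
is the distance to the span of the matrix coefficients belonging to `A`. -/
theorem l2Norm_compl_fourier (A : Finset (UnitaryDual G)) (f : Lp ℂ 2 μ) :
    l2Norm ((A : Set (UnitaryDual G))ᶜ) (fourier μ f) =
      ENNReal.ofReal ‖f - (blockSpan μ A).starProjection f‖ := by
  set g := f - (blockSpan μ A).starProjection f with hg
  -- The residual `g` has the coordinates of `f` off `A` and zero coordinates on `A`, so Parseval
  -- for `g` is the tail sum for `f`.
  have hmem : ∀ i : CoeffIndex G, i.1 ∈ A → inner ℂ (normCoeff μ i) g = 0 := fun i hi =>
    Submodule.inner_right_of_mem_orthogonal (normCoeff_mem_blockSpan μ hi)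
      (Submodule.sub_starProjection_mem_orthogonal f)
  have hnot : ∀ i : CoeffIndex G, i.1 ∉ A →
      inner ℂ (normCoeff μ i) g = inner ℂ (normCoeff μ i) f := by
    intro i hi
    have horth : normCoeff μ i ∈ (blockSpan μ A)ᗮ := by
      rw [Submodule.mem_orthogonal]
      intro u hu
      induction hu using Submodule.span_induction with
      | mem u hu =>
        obtain ⟨j, hj, rfl⟩ := hu
        refine (orthonormal_normCoeff μ).2 fun h => hi ?_
        rw [← h]
        simpa using hj
      | zero => exact inner_zero_left _
      | add u v _ _ hu hv => rw [inner_add_left, hu, hv, add_zero]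
      | smul c u _ hu => rw [inner_smul_left, hu, mul_zero]
    rw [hg, inner_sub_right, Submodule.inner_left_of_mem_orthogonal
      (Submodule.starProjection_apply_mem _ f) horth, sub_zero]
  have hsum : ∑' π : ((A : Set (UnitaryDual G))ᶜ : Set (UnitaryDual G)),
      (π.1.dim : ℝ≥0∞) * ENNReal.ofReal (hsNorm (fourier μ f π.1)) ^ 2 =
        ENNReal.ofReal (‖g‖ ^ 2) := by
    rw [← tsum_normCoeff_inner_sq, ENNReal.tsum_sigma',
      tsum_subtype ((A : Set (UnitaryDual G))ᶜ) fun π : UnitaryDual G =>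
        (π.dim : ℝ≥0∞) * ENNReal.ofReal (hsNorm (fourier μ f π)) ^ 2]
    refine tsum_congr fun π => ?_
    by_cases hπ : π ∈ A
    · rw [Set.indicator_of_notMem (by simpa using hπ)]
      simp [hmem ⟨π, _⟩ hπ]
    · rw [Set.indicator_of_mem (by simpa using hπ), dim_mul_hsNorm_fourier_sq]
      simp_rw [hnot ⟨π, _⟩ hπ]
  rw [l2Norm, hsum, ENNReal.ofReal_rpow_of_nonneg (by positivity) (by norm_num),
    ← Real.sqrt_eq_rpow, Real.sqrt_sq (norm_nonneg _)]

/-- The orthogonal projection is the best approximation, so any approximant from the block bounds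
the tail. -/
theorem hasUniformDecay_iff (K : Set (Lp ℂ 2 μ)) :
    HasUniformDecay ((fun f : Lp ℂ 2 μ => fourier μ f) '' K) ↔
      ∀ ε : ℝ, 0 < ε → ∃ A : Finset (UnitaryDual G), ∀ f ∈ K, ∃ m ∈ blockSpan μ A, ‖f - m‖ < ε := by
  refine forall₂_congr fun ε hε => exists_congr fun A => ?_
  rw [Set.forall_mem_image]
  refine forall₂_congr fun f _ => ?_
  rw [l2Norm_compl_fourier, ENNReal.ofReal_lt_ofReal_iff hε]
  refine ⟨fun h => ⟨_, Submodule.starProjection_apply_mem _ f, h⟩, ?_⟩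
  rintro ⟨m, hm, h⟩
  refine lt_of_le_of_lt ?_ h
  rw [Submodule.starProjection_minimal]
  exact ciInf_le ⟨0, by rintro _ ⟨_, rfl⟩; positivity⟩ (⟨m, hm⟩ : blockSpan μ A)

end Plancherel

/-! ### The implications between compactness, decay and equicontinuity -/

section Compactness

variable {G : Type u} [Group G] [TopologicalSpace G] [IsTopologicalGroup G] [CompactSpace G]
  [MeasurableSpace G] [BorelSpace G] (μ : Measure G) [μ.IsHaarMeasure] [IsProbabilityMeasure μ]

/-- Moving the left translation onto the coefficient changes only its first vector, to `π(x) a`,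
which is then expanded in the basis. -/
theorem innerFun_coeffLp_leftOrbit (π : IrredUnitaryRep G) {ι : Type*} [Fintype ι]
    (e : OrthonormalBasis ι ℂ π.H) (a b : π.H) (f : Lp ℂ 2 μ) :
    innerFun (π.coeffLp μ a b) (leftOrbit μ f) =
      ∑ k, inner ℂ (π.coeffLp μ (e k) b) f • π.coeff (e k) a := by
  ext x
  have h : π.coeff (π.op x a) b = ∑ k, inner ℂ (π.op x a) (e k) • π.coeff (e k) b := by
    ext y
    simp only [ContinuousMap.sum_apply, ContinuousMap.smul_apply, IrredUnitaryRep.coeff_apply,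
      smul_eq_mul, e.sum_inner_mul_inner]
  change inner ℂ (π.coeffLp μ a b) (leftTranslate μ x f) = _
  rw [inner_leftTranslate_right, leftTranslate_coeffLp, IrredUnitaryRep.coeffLp, h]
  simp only [map_sum, map_smul, sum_inner, inner_smul_left, inner_conj_symm,
    ContinuousMap.sum_apply, ContinuousMap.smul_apply, IrredUnitaryRep.coeff_apply, smul_eq_mul]
  exact Finset.sum_congr rfl fun k _ => mul_comm _ _

/-- Averaging right translates against a matrix coefficient gives matrix coefficients. -/
theorem conjIntegral_rightOrbit_mem_blockSpan {A : Finset (UnitaryDual G)} {ψ : Lp ℂ 2 μ}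
    (hψ : ψ ∈ blockSpan μ A) (f : Lp ℂ 2 μ) :
    conjIntegral μ ψ (rightOrbit μ f) ∈ blockSpan μ A := by
  -- The block is finite-dimensional, so membership can be tested against `w` orthogonal to it;
  -- Fubini then places a combination of coefficients from `A` opposite `w`.
  rw [← (blockSpan μ A).orthogonal_orthogonal, Submodule.mem_orthogonal]
  intro w hw
  rw [inner_conjIntegral]
  induction hψ using Submodule.span_induction with
  | mem ψ hψ =>
    obtain ⟨i, hi, rfl⟩ := hψ
    have hi : i.1 ∈ A := by simpa using hi
    rw [normCoeff, inner_smul_left, ← inner_innerFun_orbit,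
      innerFun_coeffLp_leftOrbit μ i.1.rep i.1.basis]
    simp only [map_sum, map_smul]
    rw [Submodule.inner_left_of_mem_orthogonal _ hw, mul_zero]
    exact Submodule.sum_mem _ fun k _ => Submodule.smul_mem _ _ (coeffLp_mem_blockSpan μ hi _ _)
  | zero => exact inner_zero_left _
  | add u v _ _ hu hv => rw [inner_add_left, hu, hv, add_zero]
  | smul c u _ hu => rw [inner_smul_left, hu, mul_zero]

theorem norm_rightOrbit_le (f : Lp ℂ 2 μ) : ‖rightOrbit μ f‖ ≤ ‖f‖ :=
  (ContinuousMap.norm_le _ (norm_nonneg _)).2 fun y => (norm_rightTranslate μ y f).le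

/-- The normalized indicator function of an open neighbourhood of the identity averages right
translates over this neighbourhood. -/
theorem exists_norm_conjIntegral_sub_le {O : Set G} (hO : IsOpen O) (h1 : (1 : G) ∈ O) :
    ∃ φ : Lp ℂ 2 μ, ∀ (f : Lp ℂ 2 μ) (δ : ℝ), (∀ y ∈ O, ‖rightTranslate μ y f - f‖ ≤ δ) →
      ‖conjIntegral μ φ (rightOrbit μ f) - f‖ ≤ δ := by
  have hpos : 0 < μ.real O :=
    ENNReal.toReal_pos (hO.measure_pos μ ⟨1, h1⟩).ne' (measure_ne_top μ O)
  refine ⟨indicatorConstLp 2 hO.measurableSet (measure_ne_top μ O) ((μ.real O : ℂ)⁻¹),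
    fun f δ hδ => ?_⟩
  have hI : conjIntegral μ (indicatorConstLp 2 hO.measurableSet (measure_ne_top μ O)
      ((μ.real O : ℂ)⁻¹)) (rightOrbit μ f) =
      (μ.real O : ℂ)⁻¹ • ∫ y in O, rightTranslate μ y f ∂μ := by
    rw [conjIntegral, ← integral_smul, ← integral_indicator hO.measurableSet]
    refine integral_congr_ae ?_
    filter_upwards [indicatorConstLp_coeFn (p := 2) (hs := hO.measurableSet)
      (hμs := measure_ne_top μ O) (c := ((μ.real O : ℂ)⁻¹))] with y hy
    rw [hy, rightOrbit_apply]
    by_cases hyO : y ∈ O <;> simp [hyO]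
  -- Writing `f` as the mean of a constant makes the difference the mean of `R_y f - f` over `O`.
  have hf : f = (μ.real O : ℂ)⁻¹ • ∫ y in O, f ∂μ := by
    rw [setIntegral_const, eq_inv_smul_iff₀ (by exact_mod_cast hpos.ne')]
    exact (RCLike.real_smul_eq_coe_smul (K := ℂ) _ _).symm
  have hfi : IntegrableOn (fun y => rightTranslate μ y f) O μ :=
    (integrable_of_continuous μ (rightOrbit μ f).continuous).integrableOn
  rw [hI]
  nth_rewrite 2 [hf]
  rw [← smul_sub, ← integral_sub hfi (integrable_const f), norm_smul, norm_inv, Complex.norm_real,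
    Real.norm_of_nonneg hpos.le, inv_mul_le_iff₀ hpos, mul_comm]
  exact norm_setIntegral_le_of_norm_le_const (measure_lt_top μ O) hδ

theorem hasUniformDecay_of_isCompact {K : Set (Lp ℂ 2 μ)} (hK : IsCompact (closure K)) :
    HasUniformDecay ((fun f : Lp ℂ 2 μ => fourier μ f) '' K) := by
  classical
  rw [hasUniformDecay_iff]
  intro ε hε
  obtain ⟨t, ht, hKt⟩ := Metric.totallyBounded_iff.1 (hK.totallyBounded.subset subset_closure)
    (ε / 2) (half_pos hε)
  choose A m hm hlt using fun f => exists_mem_blockSpan_norm_sub_lt (G := G) μ f (half_pos hε)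
  -- One finite set serves all of `K`: the union of those approximating the points of a finite net.
  refine ⟨ht.toFinset.biUnion A, fun f hf => ?_⟩
  obtain ⟨f', hf', hff'⟩ := Set.mem_iUnion₂.1 (hKt hf)
  refine ⟨m f', blockSpan_mono μ (Finset.subset_biUnion_of_mem A (ht.mem_toFinset.2 hf')) (hm f'),
    ?_⟩
  rw [Metric.mem_ball, dist_eq_norm] at hff'
  have := norm_sub_le_norm_sub_add_norm_sub f f' (m f')
  linarith [hlt f']

theorem isCompact_of_hasUniformDecay {K : Set (Lp ℂ 2 μ)} (hb : Bornology.IsBounded K)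
    (hK : HasUniformDecay ((fun f : Lp ℂ 2 μ => fourier μ f) '' K)) : IsCompact (closure K) := by
  rw [hasUniformDecay_iff] at hK
  refine (TotallyBounded.closure ?_).isCompact_of_isClosed isClosed_closure
  rw [Metric.totallyBounded_iff]
  intro ε hε
  obtain ⟨A, hA⟩ := hK (ε / 2) (half_pos hε)
  obtain ⟨C, hC⟩ := hb.exists_norm_le
  -- Approximants within `ε / 2` of points of norm at most `C` lie in this ball, which is compact in
  -- finite dimension.
  have hcomp : IsCompact ((blockSpan μ A).subtypeL ''
      Metric.closedBall (0 : blockSpan μ A) (C + ε / 2)) :=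
    (isCompact_closedBall _ _).image (blockSpan μ A).subtypeL.continuous
  obtain ⟨t, ht, hcov⟩ := Metric.totallyBounded_iff.1 hcomp.totallyBounded (ε / 2) (half_pos hε)
  refine ⟨t, ht, fun f hf => ?_⟩
  obtain ⟨m, hm, hfm⟩ := hA f hf
  have hmem : m ∈ (blockSpan μ A).subtypeL ''
      Metric.closedBall (0 : blockSpan μ A) (C + ε / 2) := by
    refine ⟨⟨m, hm⟩, ?_, rfl⟩
    rw [mem_closedBall_zero_iff]
    change ‖m‖ ≤ C + ε / 2
    have := norm_le_norm_add_norm_sub' m f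
    rw [norm_sub_rev] at this
    linarith [hC f hf]
  obtain ⟨p, hp, hmp⟩ := Set.mem_iUnion₂.1 (hcov hmem)
  refine Set.mem_iUnion₂.2 ⟨p, hp, ?_⟩
  rw [Metric.mem_ball, dist_eq_norm] at hmp ⊢
  have := norm_sub_le_norm_sub_add_norm_sub f m p
  linarith

theorem uniformlyL2Equicontinuous_of_isCompact {K : Set (Lp ℂ 2 μ)} (hK : IsCompact (closure K)) :
    UniformlyL2Equicontinuous μ K := by
  intro ε hε
  obtain ⟨t, ht, hKt⟩ := Metric.totallyBounded_iff.1 (hK.totallyBounded.subset subset_closure)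
    (ε / 3) (by positivity)
  refine ⟨⋂ p ∈ t, {y | ‖rightTranslate μ y p - p‖ < ε / 3}, ?_, ?_, fun f hf y hy => ?_⟩
  · exact ht.isOpen_biInter fun p _ => isOpen_lt
      (((rightOrbit μ p).continuous.sub continuous_const).norm) continuous_const
  · refine Set.mem_iInter₂.2 fun p _ => ?_
    rw [Set.mem_ofPred_eq, rightTranslate_one, sub_self, norm_zero]
    positivity
  · obtain ⟨p, hp, hfp⟩ := Set.mem_iUnion₂.1 (hKt hf)
    rw [Metric.mem_ball, dist_eq_norm] at hfp
    have hyp : ‖rightTranslate μ y p - p‖ < ε / 3 := Set.mem_iInter₂.1 hy p hp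
    have h : rightTranslate μ y f - f =
        rightTranslate μ y (f - p) + (rightTranslate μ y p - p) + (p - f) := by
      rw [rightTranslate_sub]; abel
    rw [h]
    refine (norm_add₃_le).trans_lt ?_
    rw [norm_rightTranslate, norm_sub_rev p f]
    linarith

theorem hasUniformDecay_of_uniformlyL2Equicontinuous {K : Set (Lp ℂ 2 μ)}
    (hb : Bornology.IsBounded K) (hK : UniformlyL2Equicontinuous μ K) :
    HasUniformDecay ((fun f : Lp ℂ 2 μ => fourier μ f) '' K) := by
  rw [hasUniformDecay_iff]
  intro ε hε
  obtain ⟨C, hC0, hC⟩ := hb.exists_pos_norm_le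
  obtain ⟨O, hO, h1, hKO⟩ := hK (ε / 2) (half_pos hε)
  obtain ⟨φ, hφ⟩ := exists_norm_conjIntegral_sub_le μ hO h1
  -- The choice of `A` depends on `φ` and `C` but not on `f`; the tolerance makes the replacement of
  -- `φ` by `ψ` cost less than `ε / 2` throughout `K`.
  obtain ⟨A, ψ, hψ, hlt⟩ := exists_mem_blockSpan_norm_sub_lt μ φ (ε := ε / (2 * C)) (by positivity)
  refine ⟨A, fun f hf => ⟨_, conjIntegral_rightOrbit_mem_blockSpan μ hψ f, ?_⟩⟩
  have h2 := hφ f (ε / 2) fun y hy => (hKO f hf y hy).le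
  have h3 := norm_conjIntegral_le μ (φ - ψ) (rightOrbit μ f)
  rw [conjIntegral_sub_left] at h3
  have h4 : ‖φ - ψ‖ * ‖rightOrbit μ f‖ < ε / 2 := by
    calc ‖φ - ψ‖ * ‖rightOrbit μ f‖ ≤ ‖φ - ψ‖ * C :=
          mul_le_mul_of_nonneg_left ((norm_rightOrbit_le μ f).trans (hC f hf)) (norm_nonneg _)
      _ < ε / (2 * C) * C := mul_lt_mul_of_pos_right hlt hC0
      _ = ε / 2 := by field_simp
  have h5 := norm_sub_le_norm_sub_add_norm_sub f (conjIntegral μ φ (rightOrbit μ f))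
    (conjIntegral μ ψ (rightOrbit μ f))
  rw [norm_sub_rev f (conjIntegral μ φ _)] at h5
  linarith

end Compactness

end CompactGroup

end

theorem theorem3p6 {G : Type u} [Group G] [TopologicalSpace G] [IsTopologicalGroup G]
    [CompactSpace G] [T2Space G] [MeasurableSpace G] [BorelSpace G]
    (μ : MeasureTheory.Measure G) [μ.IsHaarMeasure]
    [MeasureTheory.IsProbabilityMeasure μ]
    (K : Set (MeasureTheory.Lp ℂ 2 μ)) (hK : Bornology.IsBounded K) :
    List.TFAE [
      IsCompact (closure K),
      CompactGroup.HasUniformDecay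
        ((fun f : MeasureTheory.Lp ℂ 2 μ => CompactGroup.fourier μ f) '' K),
      CompactGroup.UniformlyL2Equicontinuous μ K] := by
  tfae_have 1 → 2 := CompactGroup.hasUniformDecay_of_isCompact μ
  tfae_have 2 → 1 := CompactGroup.isCompact_of_hasUniformDecay μ hK
  tfae_have 1 → 3 := CompactGroup.uniformlyL2Equicontinuous_of_isCompact μ
  tfae_have 3 → 2 := CompactGroup.hasUniformDecay_of_uniformlyL2Equicontinuous μ hK
  tfae_finish
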